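/- **Setting.** Let $\mathcal H$ be a complex Hilbert space with inner product $(\cdot,\cdot)$, linear in the first argument, let $H$ be a selfadjoint operator densely defined on $\mathcal H$ with spectral measure $E$, so that $H=\int_{\mathbb R}\omega\,dE(\omega)$, let $K$ be a densely defined linear operator on $\mathcal H$, and let $T=H+K$. Let $\Omega$ be a simply connected open domain in the upper half plane whose closure meets the real axis in an interval $\tilde I$ with nonempty interior $I$, and put $\hat\Omega=\Omega\cup I\cup\{\lambda:\operatorname{Im}\lambda<0\}$. Let $X$ be a locally convex Hausdorff space over $\mathbb C$ and $X'$ the space of continuous antilinear functionals $\mu$ on $X$, written $\phi\mapsto\langle\mu\,|\,\phi\rangle$. Assume: 1. $X$ is a dense subspace of $\mathcal H$, its topology is finer than that of $\mathcal H$, and $X$ is quasi-complete and barrelled. Let $i:X\to X'$, $\langle i\psi\,|\,\phi\rangle=(\psi,\phi)$. 2. For each $\phi\in X$ the measure $(E(\cdot)\phi,\phi)$ is absolutely continuous on $I$, and its density continues analytically to $\Omega\cup I$. By polarization, for $\psi,\phi\in X$ the complex measure $(E(\cdot)\psi,\phi)$ has on $I$ a density that continues analytically to $\Omega\cup I$;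 this continuation is written $E[\psi,\phi](z)$. For each $z\in\Omega\cup I$, $E[\cdot,\cdot](z)$ is separately continuous on $X\times X$. 3. There is a dense subspace $Y$ of $X$ with $HY\subset X$ and $K^*Y\subset X$, and $K$ is $H$-bounded. 4. $K^\times A(\lambda)\,iX\subset iX$ for all $\lambda\in\hat\Omega$, with $K^\times$ and $A(\lambda)=A^{(1)}(\lambda)$ as follows. For $A\in\{H,K,T\}$, $A^\times$ denotes the dual operator of $A^*|_Y$: $\langle A^\times\mu\,|\,y\rangle=\langle\mu\,|\,A^*y\rangle$ for $y\in Y$. For $A\in\{H,K\}$ its domain $\mathsf D(A^\times)$ is the set of those $\mu\in X'$ for which $y\mapsto\langle\mu\,|\,A^*y\rangle$ is continuous on $Y$ in the topology of $X$, and $\mathsf D(T^\times)=\mathsf D(H^\times)\cap\mathsf D(K^\times)$. For $n\ge1$ and $\lambda\in\hat\Omega$ the operator $A^{(n)}(\lambda):iX\to X'$ is defined by $$\langle A^{(n)}(\lambda)i\psi\,|\,\phi\rangle=\begin{cases}\displaystyle\int_{\mathbb R}\frac{d(E(\omega)\psi,\phi)}{(\lambda-\omega)^n}+2\pi\sqrt{-1}\,\frac{(-1)^{n-1}}{(n-1)!}\,\frac{d^{n-1}}{dz^{n-1}}\Big|_{z=\lambda}E[\psi,\phi](z)&(\lambda\in\Omega),\\[2mm]\displaystyle\lim_{y\to-0}\int_{\mathbb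 R}\frac{d(E(\omega)\psi,\phi)}{(x+\sqrt{-1}\,y-\omega)^n}&(\lambda=x\in I),\\[2mm]\displaystyle\int_{\mathbb R}\frac{d(E(\omega)\psi,\phi)}{(\lambda-\omega)^n}&(\operatorname{Im}\lambda<0).\end{cases}$$ Put $B^{(n)}(\lambda)=\mathrm{id}-A^{(n)}(\lambda)K^\times(\lambda-H^\times)^{n-1}$. All compositions and powers of operators on $X'$ carry their natural domains. A number $\lambda\in\hat\Omega$ is a *generalized eigenvalue* of $T$ if $(\mathrm{id}-A(\lambda)K^\times)\mu=0$ for some nonzero $\mu$ in the range of $A(\lambda)$. Its *generalized eigenspace* is $$V_\lambda=\bigcup_{m\ge1}\operatorname{Ker}\,B^{(m)}(\lambda)\circ B^{(m-1)}(\lambda)\circ\cdots\circ B^{(1)}(\lambda)\subset X'.$$ **Theorem 3.9.** Let $\lambda$ be a generalized eigenvalue of $T$. Then for every $\mu\in V_\lambda$ there is an integer $M\ge0$ such that $\mu$ lies in the domain of $(\lambda-T^\times)^M$ and $(\lambda-T^\times)^M\mu=0$. -/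

import Mathlib

open MeasureTheory Filter Topology Set
open scoped LinearPMap InnerProductSpace

noncomputable section

namespace GelfandTriplet

/-! ### Partially defined operators, given by their graphs

A partially defined operator `R` on `V` is represented by its graph:
`R μ ν` means that `μ` lies in the domain of `R` and `R μ = ν`. -/

/-- The operator `z - R`, with the domain of `R`. -/
def scalarSub {V : Type*} [AddCommGroup V] [Module ℂ V] (z : ℂ) (R : V → V → Prop) :
    V → V → Prop :=
  fun μ ν => ∃ κ, R μ κ ∧ ν = z • μ - κ

/-- The power `R ^ n`, with its natural domain (all intermediate values have to exist). -/
def opPow {V : Type*} (R : V → V → Prop) : ℕ → V → V → Prop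
  | 0 => fun μ ν => ν = μ
  | n + 1 => fun μ ν => ∃ ξ, opPow R n μ ξ ∧ R ξ ν

/-! ### Spectral measures -/

variable (ℋ : Type*) [NormedAddCommGroup ℋ] [InnerProductSpace ℂ ℋ] [CompleteSpace ℋ]

/-- A projection-valued measure (resolution of the identity) on the Borel sets of `ℝ`. -/
structure SpectralMeasure where
  proj : Set ℝ → (ℋ →L[ℂ] ℋ)
  isStarProjection : ∀ B, MeasurableSet B → IsStarProjection (proj B)
  proj_empty : proj ∅ = 0
  proj_univ : proj univ = 1
  proj_inter : ∀ B C, MeasurableSet B → MeasurableSet C → proj (B ∩ C) = proj B * proj C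
  hasSum_iUnion : ∀ B : ℕ → Set ℝ, (∀ n, MeasurableSet (B n)) →
    Pairwise (Function.onFun Disjoint B) →
    ∀ x, HasSum (fun n => proj (B n) x) (proj (⋃ n, B n) x)

variable {ℋ}

namespace SpectralMeasure

theorem norm_sq_eq (E : SpectralMeasure ℋ) {B : Set ℝ} (hB : MeasurableSet B) (x : ℋ) :
    ‖E.proj B x‖ ^ 2 = (inner ℂ x (E.proj B x)).re := by
  have h := E.isStarProjection B hB
  have h1 : E.proj B (E.proj B x) = E.proj B x := by
    have := h.isIdempotentElem.eq
    exact congrArg (fun f : ℋ →L[ℂ] ℋ => f x) this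
  have h2 : inner ℂ (E.proj B x) (E.proj B x) = inner ℂ x (E.proj B x) := by
    have h3 : ContinuousLinearMap.adjoint (E.proj B) = E.proj B := h.isSelfAdjoint
    conv_lhs => rw [← ContinuousLinearMap.adjoint_inner_right, h3, h1]
  rw [← h2, inner_self_eq_norm_sq_to_K]
  norm_cast

/-- The positive measure `B ↦ (E(B) x, x) = ‖E(B) x‖²`. -/
def measure (E : SpectralMeasure ℋ) (x : ℋ) : Measure ℝ :=
  Measure.ofMeasurable (fun B _ => ENNReal.ofReal (‖E.proj B x‖ ^ 2))
    (by simp [E.proj_empty])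
    (by
      intro B hB hd
      have h1 := E.hasSum_iUnion B hB hd x
      have h2 : HasSum (fun n => ‖E.proj (B n) x‖ ^ 2) (‖E.proj (⋃ n, B n) x‖ ^ 2) := by
        have h3 := Complex.hasSum_re (h1.mapL (innerSL ℂ x))
        rw [E.norm_sq_eq (MeasurableSet.iUnion hB) x]
        simp only [fun n => E.norm_sq_eq (hB n) x]
        simpa using h3
      rw [← h2.tsum_eq, ENNReal.ofReal_tsum_of_nonneg (fun n => by positivity) h2.summable])

/-- The integral `∫ f(ω) d(E(ω) x, y)` with respect to the complex measure `(E(·) x, y)`, through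
polarization: `(E(·) x, y) = ¼ ∑ₖ iᵏ (E(·) (x + iᵏ y), x + iᵏ y)`. The inner product `(·, ·)` is
linear in the first and antilinear in the second argument. -/
def integral (E : SpectralMeasure ℋ) (x y : ℋ) (f : ℝ → ℂ) : ℂ :=
  (1 / 4 : ℂ) * ∑ k ∈ Finset.range 4,
    Complex.I ^ k * ∫ ω, f ω ∂(E.measure (x + Complex.I ^ k • y))

/-- `H = ∫ ω dE(ω)`: the domain of `H` is `{x | ∫ ω² d(E(ω) x, x) < ∞}`, and
`(H x, x) = ∫ ω d(E(ω) x, x)` on it, which determines `H` by polarization. -/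
def IsSpectralMeasureOf (E : SpectralMeasure ℋ) (H : ℋ →ₗ.[ℂ] ℋ) : Prop :=
  (∀ x : ℋ, x ∈ H.domain ↔ Integrable (fun ω : ℝ => ω ^ 2) (E.measure x)) ∧
  ∀ x : H.domain, inner ℂ (x : ℋ) (H x) = ∫ ω, (ω : ℂ) ∂(E.measure (x : ℋ))

end SpectralMeasure

/-! ### The rigged Hilbert space -/

variable (ℋ)
variable (X : Type*) [AddCommGroup X] [Module ℂ X] [UniformSpace X] [IsUniformAddGroup X]
  [ContinuousSMul ℂ X]

/-- The antidual `X'`: continuous antilinear functionals on `X`. -/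
abbrev AntiDual := X →L⋆[ℂ] ℂ

/-- The objects of the setting: operators `H`, `K` on `ℋ`, the spectral measure `E` of `H`, the
domain `Ω`, the space `X` included in `ℋ` through `ι`, and the subspace `Y` of `X`. What is assumed
of them is `Setting.Admissible`. -/
structure Setting where
  H : ℋ →ₗ.[ℂ] ℋ
  K : ℋ →ₗ.[ℂ] ℋ
  E : SpectralMeasure ℋ
  Ω : Set ℂ
  ι : X →L[ℂ] ℋ
  Y : Submodule ℂ X

namespace Setting

variable {ℋ X}
variable (S : Setting ℋ X)

/-- The trace of the closure of `Ω` on the real axis. -/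
def Itilde : Set ℝ := {x | (x : ℂ) ∈ closure S.Ω}

/-- The open interval `I`, i.e. `Itilde` without its boundary points in `ℝ`. -/
def I : Set ℝ := S.Itilde \ frontier S.Itilde

/-- `Ω ∪ I` as a subset of `ℂ`. -/
def ΩI : Set ℂ := S.Ω ∪ (fun x : ℝ => (x : ℂ)) '' S.I

/-- `Ω ∪ I ∪ {Im z < 0}`. -/
def Ωhat : Set ℂ := S.ΩI ∪ {z | z.im < 0}

/-- The canonical inclusion `i : X → X'`, `⟨i ψ | φ⟩ = (ψ, φ)`. -/
def incl (ψ : X) : AntiDual X := (innerSLFlip ℂ (S.ι ψ)).comp S.ι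

/-- On `I` the complex measure `(E(·) ψ, φ)` is absolutely continuous, and `q` is an analytic
continuation to `Ω ∪ I` of its density. -/
def IsDensity (ψ φ : X) (q : ℂ → ℂ) : Prop :=
  AnalyticOnNhd ℂ q S.ΩI ∧
  IntegrableOn (fun ω : ℝ => q ω) S.I ∧
  ∀ B : Set ℝ, MeasurableSet B → B ⊆ S.I →
    inner ℂ (S.ι φ) (S.E.proj B (S.ι ψ)) = ∫ ω in B, q ω

open Classical in
/-- `E[ψ, φ](z)` for `z ∈ Ω ∪ I`: the analytically continued density, which is unique on
`Ω ∪ I`. (By polarization it exists for all `ψ, φ` as soon as it exists for all `ψ = φ`.) -/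
def density (ψ φ : X) : ℂ → ℂ :=
  if h : ∃ q, S.IsDensity ψ φ q then h.choose else 0

/-- The dual operator `(A|_Y)'` on `X'` of an operator `A` on `ℋ` that maps `Y` into `X`:
`ν = A' μ` if `⟨ν | y⟩ = ⟨μ | A y⟩` for all `y ∈ Y`. The domain consists of the `μ` for which
`y ↦ ⟨μ | A y⟩` is continuous on the dense subspace `Y`, i.e. extends to some `ν ∈ X'`. -/
def dual (A : ℋ →ₗ.[ℂ] ℋ) : AntiDual X → AntiDual X → Prop :=
  fun μ ν => ∀ y ∈ S.Y, ∀ x : X, (S.ι y, S.ι x) ∈ A.graph → ν y = μ x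

/-- `H^× = (H^*)'`. -/
def Hx : AntiDual X → AntiDual X → Prop := S.dual S.H†

/-- `K^× = (K^*)'`. -/
def Kx : AntiDual X → AntiDual X → Prop := S.dual S.K†

/-- `T = H + K` as an operator on `ℋ`. -/
def T : ℋ →ₗ.[ℂ] ℋ := S.H + S.K

/-- `T^× = (T^*)'`, on the domain `D(H^×) ∩ D(K^×)`. -/
def Tx : AntiDual X → AntiDual X → Prop :=
  fun μ ν => S.dual S.T† μ ν ∧ (∃ κ, S.Hx μ κ) ∧ (∃ κ, S.Kx μ κ)

/-- `ν = A⁽ⁿ⁾(z) i ψ` for `n ≥ 1`: the analytic continuation of `(z - H)⁻ⁿ ψ` from the lower half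
plane to `Ω ∪ I`, as an element of `X'`. -/
def IsA (n : ℕ) (z : ℂ) (ψ : X) (ν : AntiDual X) : Prop :=
  ∀ φ : X,
    (z ∈ S.Ω → ν φ = S.E.integral (S.ι ψ) (S.ι φ) (fun ω => 1 / (z - ω) ^ n) +
      2 * Real.pi * Complex.I * ((-1) ^ (n - 1) / (n - 1).factorial) *
        iteratedDeriv (n - 1) (S.density ψ φ) z) ∧
    (∀ x ∈ S.I, z = x → Tendsto (fun y : ℝ => S.E.integral (S.ι ψ) (S.ι φ)
      (fun ω => 1 / ((x : ℂ) + Complex.I * y - ω) ^ n)) (𝓝[<] 0) (𝓝 (ν φ))) ∧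
    (z.im < 0 → ν φ = S.E.integral (S.ι ψ) (S.ι φ) (fun ω => 1 / (z - ω) ^ n))

/-- `B⁽ⁿ⁾(z) = id - A⁽ⁿ⁾(z) K^× (z - H^×)ⁿ⁻¹` for `n ≥ 1`, with its natural domain;
`A⁽ⁿ⁾(z)` has the domain `i X`. -/
def B (n : ℕ) (z : ℂ) : AntiDual X → AntiDual X → Prop :=
  fun μ ν => ∃ (ξ : AntiDual X) (ψ : X) (α : AntiDual X),
    opPow (scalarSub z S.Hx) (n - 1) μ ξ ∧ S.Kx ξ (S.incl ψ) ∧ S.IsA n z ψ α ∧ ν = μ - α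

/-- `B⁽ᵐ⁾(z) ∘ ⋯ ∘ B⁽¹⁾(z)`, with its natural domain. -/
def Bcomp (z : ℂ) : ℕ → AntiDual X → AntiDual X → Prop
  | 0 => fun μ ν => ν = μ
  | m + 1 => fun μ ν => ∃ ξ, Bcomp z m μ ξ ∧ S.B (m + 1) z ξ ν

/-- `z` is a generalized eigenvalue of `T`: `z ∈ Ω ∪ I ∪ {Im z < 0}`, and
`(id - A(z) K^×) μ = 0` has a nonzero solution `μ` in the range of `A(z)`. -/
def IsGeneralizedEigenvalue (z : ℂ) : Prop :=
  z ∈ S.Ωhat ∧ ∃ μ : AntiDual X, μ ≠ 0 ∧ (∃ ψ, S.IsA 1 z ψ μ) ∧ S.B 1 z μ 0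

/-- The generalized eigenspace `V_z`. -/
def genEigenspace (z : ℂ) : Set (AntiDual X) :=
  {μ | ∃ m : ℕ, 1 ≤ m ∧ S.Bcomp z m μ 0}

/-- The standing assumptions. -/
structure Admissible : Prop where
  /-- `H` is selfadjoint, densely defined, with spectral measure `E`. -/
  dense_H : Dense (S.H.domain : Set ℋ)
  selfAdjoint_H : IsSelfAdjoint S.H
  spectral_E : S.E.IsSpectralMeasureOf S.H
  dense_K : Dense (S.K.domain : Set ℋ)
  /-- `Ω` is a simply connected domain in the upper half plane whose closure meets the real axis
  in an interval with nonempty interior `I`. -/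
  isOpen_Ω : IsOpen S.Ω
  simplyConnected_Ω : IsSimplyConnected S.Ω
  im_pos_Ω : ∀ z ∈ S.Ω, 0 < z.im
  interval : S.Itilde.OrdConnected
  nonempty_I : S.I.Nonempty
  /-- `X` is a dense subspace of `ℋ` (with a finer topology, as `ι` is continuous). -/
  injective_ι : Function.Injective S.ι
  dense_ι : DenseRange S.ι
  /-- `X` is quasi-complete and barrelled. -/
  quasiComplete : QuasiCompleteSpace ℂ X
  barrelled : BarrelledSpace ℂ X
  /-- `(E(·) φ, φ)` has on `I` a density that continues analytically to `Ω ∪ I`. -/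
  density_exists : ∀ φ : X, ∃ q, S.IsDensity φ φ q
  /-- `E[·, ·](z)` is separately continuous for `z ∈ Ω ∪ I`. -/
  density_continuous_left : ∀ z ∈ S.ΩI, ∀ φ : X, Continuous fun ψ : X => S.density ψ φ z
  density_continuous_right : ∀ z ∈ S.ΩI, ∀ ψ : X, Continuous fun φ : X => S.density ψ φ z
  /-- `Y` is dense in `X`, and `H Y ⊆ X`. -/
  dense_Y : Dense (S.Y : Set X)
  map_H : ∀ y ∈ S.Y, ∃ x : X, (S.ι y, S.ι x) ∈ S.H.graph
  /-- `K` is `H`-bounded, and `K^* Y ⊆ X`. -/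
  domain_le : S.H.domain ≤ S.K.domain
  relBounded : ∃ a b : ℝ, ∀ x (hx : x ∈ S.H.domain),
    ‖S.K ⟨x, domain_le hx⟩‖ ≤ a * ‖S.H ⟨x, hx⟩‖ + b * ‖x‖
  map_K : ∀ y ∈ S.Y, ∃ x : X, (S.ι y, S.ι x) ∈ S.K†.graph
  /-- `K^× A(z) i X ⊆ i X` for `z ∈ Ω ∪ I ∪ {Im z < 0}`. -/
  map_KxA : ∀ z ∈ S.Ωhat, ∀ (ψ : X) (α : AntiDual X), S.IsA 1 z ψ α →
    ∃ χ : X, S.Kx α (S.incl χ)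

end Setting

end GelfandTriplet

end

/-! The theorem rests on an inclusion of operators with natural domains: (λ - H^×)^m B^(m)(λ) ⋯
B^(1)(λ) ⊆ (λ - T^×)^m (`opPow_scalarSub_Tx_of_Bcomp`). A vector of V_λ is sent to 0 by the product
of the B's for some m, and 0 lies in the domain of every power of λ - H^×, so M = m works.

The inclusion is proved by induction on m from (λ - H^×)^n A^(n)(λ) iψ = iψ for n ≥ 1 (`IsA.opPow`)
and H^× + K^× ⊆ T^× (`Tx_add`). If ξ = B^(m) ⋯ B^(1) μ and ζ = (λ - H^×)^m ξ, then ζ = (λ - T^×)^m μ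
by induction, and (λ - H^×)^(m+1) B^(m+1) ξ = (λ - H^×)ζ - K^× ζ = (λ - T^×)ζ.

Each factor λ - H^× lowers the order of A^(n)(λ) by one (`IsA.scalarSub_one`, `IsA.scalarSub_succ`).
For the resolvent integrals this is spectral calculus; for the continued terms on Ω it is E[ψ,Hφ](z)
= z E[ψ,φ](z) (`density_apply`) and the Leibniz rule; on I it passes to the limit from below. The
natural domains also require the intermediate A^(n)(λ) iψ to exist in X', which `IsA.exists_pred`
obtains from barrelledness. -/

namespace GelfandTriplet

/-! ### Integrals against the complex measures (E(·)x, y) -/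

/-- A vanishing linear combination of finite measures with bounded densities annihilates all
functions that are integrable for each of the measures. -/
theorem sum_integral_mul_eq_zero {ι α : Type*} [MeasurableSpace α] (s : Finset ι)
    (μ : ι → Measure α) [∀ j, IsFiniteMeasure (μ j)] (g : ι → α → ℂ)
    (hg : ∀ j, Measurable (g j)) (C : ι → ℝ) (hC : ∀ j a, ‖g j a‖ ≤ C j)
    (h : ∀ B, MeasurableSet B → ∑ j ∈ s, ∫ a in B, g j a ∂(μ j) = 0)
    (f : α → ℂ) (hf : ∀ j ∈ s, Integrable f (μ j)) :
    ∑ j ∈ s, ∫ a, f a * g j a ∂(μ j) = 0 := by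
  classical
  set M : Measure α := ∑ j ∈ s, μ j with hM
  have hle : ∀ j ∈ s, μ j ≤ M := fun j hj => by
    rw [hM, ← Finset.add_sum_erase s μ hj]
    exact Measure.le_add_right le_rfl
  have hint : ∀ j ∈ s, ∀ {f : α → ℂ}, Integrable f M → Integrable (fun a => f a * g j a) (μ j) :=
    fun j hj f hf => (hf.mono_measure (hle j hj)).mul_bdd
      (hg j).aestronglyMeasurable (ae_of_all _ (hC j))
  have hfM : Integrable f M := by
    rw [hM]
    exact integrable_finsetSum_measure.2 hf
  refine Integrable.induction (μ := M)
    (P := fun f => ∑ j ∈ s, ∫ a, f a * g j a ∂(μ j) = 0) ?_ ?_ ?_ ?_ hfM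
  · intro c B hB _
    have : ∀ j, ∫ a, B.indicator (fun _ => c) a * g j a ∂(μ j) = c * ∫ a in B, g j a ∂(μ j) := by
      intro j
      rw [← integral_const_mul, ← integral_indicator hB]
      congr 1
      ext a
      by_cases ha : a ∈ B <;> simp [ha]
    simp only [this, ← Finset.mul_sum, h B hB, mul_zero]
  · intro f₁ f₂ _ h₁ h₂ hP₁ hP₂
    have : ∀ j ∈ s, ∫ a, (f₁ + f₂) a * g j a ∂(μ j) =
        ∫ a, f₁ a * g j a ∂(μ j) + ∫ a, f₂ a * g j a ∂(μ j) := by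
      intro j hj
      rw [← integral_add (hint j hj h₁) (hint j hj h₂)]
      simp only [Pi.add_apply, add_mul]
    rw [Finset.sum_congr rfl this, Finset.sum_add_distrib, hP₁, hP₂, add_zero]
  -- Each summand is Lipschitz on L¹(M) with constant `C j`, because `μ j ≤ M`; so the vanishing set
  -- is closed.
  · refine isClosed_eq ?_ continuous_const
    refine continuous_finsetSum _ fun j hj => ?_
    have hCj : ∀ a : α, 0 ≤ C j := fun a => (norm_nonneg _).trans (hC j a)
    refine (LipschitzWith.of_dist_le_mul (K := (C j).toNNReal) fun f₁ f₂ => ?_).continuous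
    have h₁ := L1.integrable_coeFn f₁
    have h₂ := L1.integrable_coeFn f₂
    have h₁₂ := L1.integrable_coeFn (f₁ - f₂)
    have hsub : (f₁ - f₂ : α →₁[M] ℂ) =ᵐ[μ j] fun a => f₁ a - f₂ a :=
      (Measure.absolutelyContinuous_of_le (hle j hj)).ae_le (Lp.coeFn_sub f₁ f₂)
    rw [dist_eq_norm, dist_eq_norm, ← integral_sub (hint j hj h₁) (hint j hj h₂),
      L1.norm_eq_integral_norm, ← integral_const_mul]
    calc ‖∫ a, (f₁ a * g j a - f₂ a * g j a) ∂(μ j)‖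
        ≤ ∫ a, (C j).toNNReal * ‖(f₁ - f₂ : α →₁[M] ℂ) a‖ ∂(μ j) := by
          refine norm_integral_le_of_norm_le
            ((h₁₂.norm.mono_measure (hle j hj)).const_mul _) ?_
          filter_upwards [hsub] with a ha
          rw [ha, ← sub_mul, norm_mul, mul_comm, Real.coe_toNNReal _ (hCj a)]
          exact mul_le_mul_of_nonneg_right (hC j a) (norm_nonneg _)
      _ ≤ ∫ a, (C j).toNNReal * ‖(f₁ - f₂ : α →₁[M] ℂ) a‖ ∂M :=
          integral_mono_measure (hle j hj) (ae_of_all _ fun a => by positivity)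
            (h₁₂.norm.const_mul _)
  · intro f₁ f₂ hff _ hP
    rw [← hP]
    refine Finset.sum_congr rfl fun j hj => integral_congr_ae ?_
    filter_upwards [(Measure.absolutelyContinuous_of_le (hle j hj)).ae_le hff] with a ha
    rw [ha]

theorem inner_eq_sum_norm_sq {V : Type*} [NormedAddCommGroup V] [InnerProductSpace ℂ V]
    (u v : V) :
    inner ℂ v u =
      (1 / 4 : ℂ) * ∑ k ∈ Finset.range 4, Complex.I ^ k * ((‖u + Complex.I ^ k • v‖ ^ 2 : ℝ) : ℂ) := by
  have h : ∀ w : V, ((‖w‖ ^ 2 : ℝ) : ℂ) = inner ℂ w w := fun w => by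
    rw [inner_self_eq_norm_sq_to_K]; norm_cast
  have h3 : Complex.I ^ 3 = -Complex.I := by simp
  simp only [h]
  simp only [Finset.sum_range_succ, Finset.sum_range_zero, inner_add_left, inner_add_right,
    inner_smul_left, inner_smul_right, Complex.I_sq, h3, pow_zero, pow_one, map_one, map_neg,
    Complex.conj_I]
  ring_nf
  simp only [Complex.I_sq]
  ring

namespace SpectralMeasure

variable {ℋ : Type*} [NormedAddCommGroup ℋ] [InnerProductSpace ℂ ℋ] [CompleteSpace ℋ]
variable (E : SpectralMeasure ℋ)

theorem measure_apply (x : ℋ) {B : Set ℝ} (hB : MeasurableSet B) :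
    E.measure x B = ENNReal.ofReal (‖E.proj B x‖ ^ 2) := by
  rw [measure, Measure.ofMeasurable_apply _ hB]

instance isFiniteMeasure_measure (x : ℋ) : IsFiniteMeasure (E.measure x) :=
  ⟨by rw [E.measure_apply x MeasurableSet.univ]; exact ENNReal.ofReal_lt_top⟩

theorem measureReal_apply (x : ℋ) {B : Set ℝ} (hB : MeasurableSet B) :
    (E.measure x).real B = ‖E.proj B x‖ ^ 2 := by
  rw [Measure.real, E.measure_apply x hB, ENNReal.toReal_ofReal (by positivity)]

theorem measureReal_univ (x : ℋ) : (E.measure x).real univ = ‖x‖ ^ 2 := by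
  rw [E.measureReal_apply x MeasurableSet.univ, E.proj_univ]; simp

theorem proj_proj {B C : Set ℝ} (hB : MeasurableSet B) (hC : MeasurableSet C) (x : ℋ) :
    E.proj B (E.proj C x) = E.proj (B ∩ C) x := by
  rw [E.proj_inter B C hB hC]; rfl

theorem inner_proj_proj {B : Set ℝ} (hB : MeasurableSet B) (x y : ℋ) :
    inner ℂ (E.proj B y) (E.proj B x) = inner ℂ y (E.proj B x) := by
  have h3 : ContinuousLinearMap.adjoint (E.proj B) = E.proj B :=
    (E.isStarProjection B hB).isSelfAdjoint
  rw [← ContinuousLinearMap.adjoint_inner_right, h3, E.proj_proj hB hB, inter_self]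

theorem setIntegral_one_polarization {B : Set ℝ} (hB : MeasurableSet B) (x y : ℋ) :
    (1 / 4 : ℂ) * ∑ k ∈ Finset.range 4,
      Complex.I ^ k * ∫ _ in B, (1 : ℂ) ∂(E.measure (x + Complex.I ^ k • y)) =
      inner ℂ y (E.proj B x) := by
  rw [← E.inner_proj_proj hB, inner_eq_sum_norm_sq]
  simp only [setIntegral_const, E.measureReal_apply _ hB, map_add, map_smul]
  simp

theorem integrable_of_bounded {f : ℝ → ℂ} (hf : Measurable f) {C : ℝ} (hC : ∀ ω, ‖f ω‖ ≤ C)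
    (x : ℋ) : Integrable f (E.measure x) :=
  Integrable.of_bound hf.aestronglyMeasurable C (ae_of_all _ hC)

/-- A linear relation between the complex measures `(E(·) x, y)`, with bounded weights, passes to
the integrals. -/
theorem sum_integral_eq_zero {ι : Type*} (s : Finset ι) (x y : ι → ℋ) (g : ι → ℝ → ℂ)
    (hg : ∀ j, Measurable (g j)) (C : ι → ℝ) (hC : ∀ j a, ‖g j a‖ ≤ C j)
    (h : ∀ B, MeasurableSet B → ∑ j ∈ s, E.integral (x j) (y j) (B.indicator (g j)) = 0)
    (f : ℝ → ℂ)
    (hf : ∀ j ∈ s, ∀ k ∈ Finset.range 4, Integrable f (E.measure (x j + Complex.I ^ k • y j))) :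
    ∑ j ∈ s, E.integral (x j) (y j) (fun ω => f ω * g j ω) = 0 := by
  have key := sum_integral_mul_eq_zero (s ×ˢ Finset.range 4)
    (fun p => E.measure (x p.1 + Complex.I ^ p.2 • y p.1))
    (fun p ω => (1 / 4 * Complex.I ^ p.2) * g p.1 ω)
    (fun p => (hg p.1).const_mul _) (fun p => ‖(1 / 4 * Complex.I ^ p.2 : ℂ)‖ * C p.1)
    (fun p a => by
      rw [norm_mul]
      exact mul_le_mul_of_nonneg_left (hC _ _) (norm_nonneg _))
    (fun B hB => by
      rw [← h B hB, Finset.sum_product]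
      refine Finset.sum_congr rfl fun j _ => ?_
      simp only [integral, Finset.mul_sum, integral_const_mul, integral_indicator hB, mul_assoc])
    f (fun p hp => hf p.1 (Finset.mem_product.1 hp).1 p.2 (Finset.mem_product.1 hp).2)
  rw [← key, Finset.sum_product]
  refine Finset.sum_congr rfl fun j _ => ?_
  simp only [integral, Finset.mul_sum]
  refine Finset.sum_congr rfl fun k _ => ?_
  rw [← mul_assoc, ← integral_const_mul]
  congr 1
  ext ω
  ring

theorem integral_indicator_const {B : Set ℝ} (hB : MeasurableSet B) (x y : ℋ) (c : ℂ) :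
    E.integral x y (B.indicator fun _ => c) = c * inner ℂ y (E.proj B x) := by
  rw [← E.setIntegral_one_polarization hB, integral]
  simp only [integral_indicator hB, Finset.mul_sum]
  refine Finset.sum_congr rfl fun k _ => ?_
  simp only [setIntegral_const, mul_one, Complex.real_smul]
  ring

theorem integral_one (x y : ℋ) : E.integral x y (fun _ => 1) = inner ℂ y x := by
  have := E.integral_indicator_const MeasurableSet.univ x y 1
  simpa [E.proj_univ] using this

/-- The polarized definition is not visibly additive in `y`. The weights 1, -1, -1 express
additivity of the complex measures, which on each Borel set is additivity of the inner product;
`sum_integral_eq_zero` transfers it to `f`. -/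
theorem integral_add_right {f : ℝ → ℂ} (hf : ∀ x, Integrable f (E.measure x)) (x y y' : ℋ) :
    E.integral x (y + y') f = E.integral x y f + E.integral x y' f := by
  have := E.sum_integral_eq_zero Finset.univ (fun _ : Fin 3 => x) ![y + y', y, y']
    (fun j _ => ![1, -1, -1] j) (fun j => measurable_const) (fun j => ‖(![1, -1, -1] j : ℂ)‖)
    (fun j a => le_rfl)
    (fun B hB => by
      simp only [E.integral_indicator_const hB, Fin.sum_univ_three]
      simp)
    f (fun _ _ _ _ => hf _)
  simp only [Fin.sum_univ_three, integral, integral_mul_const] at this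
  simp only [integral]
  simp only [Finset.sum_range_succ, Finset.sum_range_zero] at this ⊢
  simp at this ⊢
  linear_combination this

theorem integral_smul_right {f : ℝ → ℂ} (hf : ∀ x, Integrable f (E.measure x)) (x y : ℋ) (c : ℂ) :
    E.integral x (c • y) f = starRingEnd ℂ c * E.integral x y f := by
  have := E.sum_integral_eq_zero Finset.univ (fun _ : Fin 2 => x) ![c • y, y]
    (fun j _ => ![1, -starRingEnd ℂ c] j) (fun j => measurable_const)
    (fun j => ‖(![1, -starRingEnd ℂ c] j : ℂ)‖)
    (fun j a => le_rfl)
    (fun B hB => by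
      simp only [E.integral_indicator_const hB, Fin.sum_univ_two]
      simp [mul_comm])
    f (fun _ _ _ _ => hf _)
  simp only [Fin.sum_univ_two, integral, integral_mul_const] at this
  simp only [integral]
  simp only [Finset.sum_range_succ, Finset.sum_range_zero] at this ⊢
  simp at this ⊢
  linear_combination this

theorem norm_integral_le {f : ℝ → ℂ} {C : ℝ} (hC : ∀ ω, ‖f ω‖ ≤ C) (x y : ℋ) :
    ‖E.integral x y f‖ ≤ C * (‖x‖ + ‖y‖) ^ 2 := by
  have hC0 : 0 ≤ C := (norm_nonneg _).trans (hC 0)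
  have h1 : ∀ k ∈ Finset.range 4, ‖Complex.I ^ k * ∫ ω, f ω ∂(E.measure (x + Complex.I ^ k • y))‖ ≤
      C * (‖x‖ + ‖y‖) ^ 2 := by
    intro k _
    rw [norm_mul, norm_pow, Complex.norm_I, one_pow, one_mul]
    refine (norm_integral_le_of_norm_le_const (ae_of_all _ hC)).trans ?_
    rw [E.measureReal_univ]
    gcongr
    refine (norm_add_le _ _).trans ?_
    simp [norm_smul]
  rw [integral, norm_mul]
  refine (mul_le_mul_of_nonneg_left (norm_sum_le_of_le _ h1) (norm_nonneg _)).trans ?_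
  simp

/-- `y ↦ ∫ f(ω) d(E(ω) x, y)` as a continuous antilinear functional, for bounded `f`. -/
theorem exists_antilinear {f : ℝ → ℂ} (hf : Measurable f) {C : ℝ} (hC : ∀ ω, ‖f ω‖ ≤ C) (x : ℋ) :
    ∃ Λ : ℋ →L⋆[ℂ] ℂ, ∀ y, Λ y = E.integral x y f := by
  have hint := E.integrable_of_bounded hf hC
  let Λ₀ : ℋ →ₗ⋆[ℂ] ℂ :=
    { toFun := fun y => E.integral x y f
      map_add' := E.integral_add_right hint x
      map_smul' := fun c y => E.integral_smul_right hint x y c }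
  refine ⟨Λ₀.mkContinuous (C * (‖x‖ + 1) ^ 2) fun y => ?_, fun y => rfl⟩
  by_cases hy : y = 0
  · simp [hy]
  have hy' : ‖y‖ ≠ 0 := norm_ne_zero_iff.2 hy
  -- The bound C(‖x‖ + ‖y‖)² is not homogeneous in `y`; normalizing `y` and using antilinearity
  -- turns it into a linear one.
  set u : ℋ := ((‖y‖ : ℂ)⁻¹) • y with hu
  have hyu : y = (‖y‖ : ℂ) • u := by
    rw [hu, smul_smul, mul_inv_cancel₀ (by exact_mod_cast hy'), one_smul]
  have hu1 : ‖u‖ = 1 := by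
    rw [hu, norm_smul, norm_inv, Complex.norm_real, norm_norm, inv_mul_cancel₀ hy']
  have h1 := E.norm_integral_le hC x u
  rw [hu1] at h1
  have h2 : Λ₀ y = (‖y‖ : ℂ) * Λ₀ u := by
    conv_lhs => rw [hyu, LinearMap.map_smulₛₗ]
    simp
  rw [h2, norm_mul, Complex.norm_real, norm_norm, mul_comm]
  exact mul_le_mul_of_nonneg_right h1 (norm_nonneg _)

end SpectralMeasure

/-! ### Spectral calculus for H -/

namespace SpectralMeasure

variable {ℋ : Type*} [NormedAddCommGroup ℋ] [InnerProductSpace ℂ ℋ] [CompleteSpace ℋ]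
variable (E : SpectralMeasure ℋ)

theorem integrable_indicator_mul {B : Set ℝ} (hB : MeasurableSet B) {N : ℝ}
    (hN : ∀ ω ∈ B, |ω| ≤ N) (x : ℋ) :
    Integrable (B.indicator fun ω : ℝ => (ω : ℂ)) (E.measure x) := by
  refine E.integrable_of_bounded (C := max N 0)
    (Complex.measurable_ofReal.indicator hB) (fun ω => ?_) x
  by_cases hω : ω ∈ B
  · simpa [hω] using Or.inl (hN ω hω)
  · simp [hω]

theorem measure_proj {B : Set ℝ} (hB : MeasurableSet B) (x : ℋ) :
    E.measure (E.proj B x) = (E.measure x).restrict B := by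
  ext C hC
  rw [Measure.restrict_apply hC, E.measure_apply _ hC, E.measure_apply _ (hC.inter hB),
    E.proj_proj hC hB]

theorem integral_add_fun {f g : ℝ → ℂ} {x y : ℋ}
    (hf : ∀ k ∈ Finset.range 4, Integrable f (E.measure (x + Complex.I ^ k • y)))
    (hg : ∀ k ∈ Finset.range 4, Integrable g (E.measure (x + Complex.I ^ k • y))) :
    E.integral x y (fun ω => f ω + g ω) = E.integral x y f + E.integral x y g := by
  simp only [integral]
  rw [← mul_add, ← Finset.sum_add_distrib]
  congr 1
  refine Finset.sum_congr rfl fun k hk => ?_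
  rw [MeasureTheory.integral_add (hf k hk) (hg k hk), mul_add]

theorem integral_const_mul (x y : ℋ) (c : ℂ) (f : ℝ → ℂ) :
    E.integral x y (fun ω => c * f ω) = c * E.integral x y f := by
  simp only [integral, MeasureTheory.integral_const_mul, Finset.mul_sum]
  refine Finset.sum_congr rfl fun k _ => by ring

theorem integral_eq_of_forall_indicator {x y x' y' : ℋ} {g g' : ℝ → ℂ}
    (hg : Measurable g) (hg' : Measurable g') {C : ℝ} (hC : ∀ a, ‖g a‖ ≤ C) (hC' : ∀ a, ‖g' a‖ ≤ C)
    (h : ∀ B, MeasurableSet B →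
      E.integral x y (B.indicator g) = E.integral x' y' (B.indicator g'))
    {f : ℝ → ℂ}
    (hf : ∀ k ∈ Finset.range 4, Integrable f (E.measure (x + Complex.I ^ k • y)))
    (hf' : ∀ k ∈ Finset.range 4, Integrable f (E.measure (x' + Complex.I ^ k • y'))) :
    E.integral x y (fun ω => f ω * g ω) = E.integral x' y' (fun ω => f ω * g' ω) := by
  have key := E.sum_integral_eq_zero Finset.univ ![x, x'] ![y, y'] ![g, fun ω => -1 * g' ω]
    (by
      intro j
      fin_cases j
      · exact hg
      · exact hg'.const_mul _)
    ![C, C]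
    (by
      intro j a
      fin_cases j
      · exact hC a
      · simpa using hC' a)
    (fun B hB => by
      have hneg : B.indicator (fun ω => -1 * g' ω) = fun ω => -1 * B.indicator g' ω := by
        ext ω
        by_cases hω : ω ∈ B <;> simp [hω]
      simp only [Fin.sum_univ_two, Matrix.cons_val_zero, Matrix.cons_val_one, hneg]
      rw [E.integral_const_mul, h B hB]
      ring)
    f
    (by
      intro j _
      fin_cases j
      · exact hf
      · exact hf')
  have hneg : (fun ω => f ω * (-1 * g' ω)) = fun ω => -1 * (f ω * g' ω) := by
    ext ω
    ring
  simp only [Fin.sum_univ_two, Matrix.cons_val_zero, Matrix.cons_val_one, hneg] at key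
  rw [E.integral_const_mul] at key
  linear_combination key

/-- The measure (E(·)E(B)x, y) vanishes on subsets of the complement of `B` and agrees with (E(·)x,
y) on subsets of `B`. Here `f` may be unbounded, as is needed for f(ω) = ω. -/
theorem integral_proj {B : Set ℝ} (hB : MeasurableSet B) (x y : ℋ) {f : ℝ → ℂ}
    (hf : ∀ k ∈ Finset.range 4, Integrable f (E.measure (E.proj B x + Complex.I ^ k • y)))
    (hfB : ∀ v, Integrable (B.indicator f) (E.measure v)) :
    E.integral (E.proj B x) y f = E.integral x y (B.indicator f) := by
  have hm : ∀ C : Set ℝ, MeasurableSet C → Measurable (C.indicator fun _ => (1 : ℂ)) :=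
    fun C hC => measurable_const.indicator hC
  have hb : ∀ (C : Set ℝ) (a : ℝ), ‖C.indicator (fun _ => (1 : ℂ)) a‖ ≤ 1 := fun C a =>
    (norm_indicator_le_norm_self _ _).trans (by simp)
  have h₁ : E.integral (E.proj B x) y (fun ω => f ω * Bᶜ.indicator (fun _ => 1) ω) =
      E.integral 0 0 (fun ω => f ω * (fun _ => (0 : ℂ)) ω) := by
    refine E.integral_eq_of_forall_indicator (C := 1) (hm _ hB.compl) measurable_const (hb _)
      (by simp) (fun C hC => ?_) hf (by simp [measure])
    rw [indicator_indicator, E.integral_indicator_const (hC.inter hB.compl),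
      E.integral_indicator_const hC, E.proj_proj (hC.inter hB.compl) hB]
    simp [inter_assoc, E.proj_empty]
  have h₂ : E.integral (E.proj B x) y (fun ω => B.indicator f ω * (fun _ => (1 : ℂ)) ω) =
      E.integral x y (fun ω => B.indicator f ω * B.indicator (fun _ => (1 : ℂ)) ω) := by
    refine E.integral_eq_of_forall_indicator (C := 1) measurable_const (hm _ hB)
      (by simp) (hb _) (fun C hC => ?_) (fun k _ => hfB _) (fun k _ => hfB _)
    rw [indicator_indicator, E.integral_indicator_const (hC.inter hB),
      E.integral_indicator_const hC, E.proj_proj hC hB]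
  have h₃ : f = fun ω => B.indicator f ω + f ω * Bᶜ.indicator (fun _ => 1) ω := by
    ext ω
    by_cases hω : ω ∈ B <;> simp [hω]
  have h₄ : (fun ω => B.indicator f ω * B.indicator (fun _ => (1 : ℂ)) ω) = B.indicator f := by
    ext ω
    by_cases hω : ω ∈ B <;> simp [hω]
  rw [h₄] at h₂
  simp only [mul_one] at h₂
  conv_lhs => rw [h₃]
  rw [E.integral_add_fun (fun k _ => hfB _), h₁, h₂]
  · simp [integral]
  · intro k hk
    exact (hf k hk).mul_bdd (c := 1) (hm _ hB.compl).aestronglyMeasurable (ae_of_all _ (hb _))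

variable {E} {H : ℋ →ₗ.[ℂ] ℋ}

namespace IsSpectralMeasureOf

variable (hE : E.IsSpectralMeasureOf H)

include hE

theorem integrable_id {x : ℋ} (hx : x ∈ H.domain) :
    Integrable (fun ω : ℝ => (ω : ℂ)) (E.measure x) := by
  refine Integrable.ofReal ?_
  refine (((hE.1 x).1 hx).add (integrable_const (1 : ℝ))).mono'
    measurable_id.aestronglyMeasurable (ae_of_all _ fun ω => ?_)
  simp only [Pi.add_apply, Real.norm_eq_abs]
  nlinarith [sq_nonneg (|ω| - 1), sq_abs ω, abs_nonneg ω]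

theorem inner_eq_integral (u v : H.domain) :
    inner ℂ (v : ℋ) (H u) = E.integral (u : ℋ) (v : ℋ) (fun ω => (ω : ℂ)) := by
  have h := fun k : ℕ => hE.2 (u + Complex.I ^ k • v)
  have h3 : Complex.I ^ 3 = -Complex.I := by simp
  simp only [integral]
  simp only [Submodule.coe_add, Submodule.coe_smul] at h
  simp only [← h, LinearPMap.map_add, LinearPMap.map_smul]
  simp only [Finset.sum_range_succ, Finset.sum_range_zero, inner_add_left, inner_add_right,
    inner_smul_left, inner_smul_right, Complex.I_sq, h3, pow_zero, pow_one, map_one, map_neg,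
    Complex.conj_I]
  ring_nf
  simp only [Complex.I_sq]
  ring

theorem proj_mem_domain {B : Set ℝ} (hB : MeasurableSet B) {N : ℝ} (hN : ∀ ω ∈ B, |ω| ≤ N)
    (x : ℋ) : E.proj B x ∈ H.domain := by
  rw [hE.1, E.measure_proj hB]
  refine Integrable.of_bound (by fun_prop) (N ^ 2) ?_
  filter_upwards [ae_restrict_mem hB] with ω hω
  rw [Real.norm_eq_abs, abs_pow]
  have := hN ω hω
  gcongr

variable (hH : IsSelfAdjoint H)

include hH

/-- As `B` is bounded, E(B)x lies in the domain of `H`; symmetry moves `H` onto it, where the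
spectral formula applies. -/
theorem inner_apply_proj (y : H.domain) {B : Set ℝ} (hB : MeasurableSet B) {N : ℝ}
    (hN : ∀ ω ∈ B, |ω| ≤ N) (x : ℋ) :
    inner ℂ (H y) (E.proj B x) = E.integral x (y : ℋ) (B.indicator fun ω => (ω : ℂ)) := by
  have hsymm : H.IsFormalAdjoint H := by
    have := LinearPMap.adjoint_isFormalAdjoint hH.dense_domain
    rwa [LinearPMap.isSelfAdjoint_def.1 hH] at this
  set u : H.domain := ⟨E.proj B x, hE.proj_mem_domain hB hN x⟩ with hu
  have h1 : inner ℂ (H y) (u : ℋ) = inner ℂ (y : ℋ) (H u) := hsymm y u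
  rw [← E.integral_proj hB, ← hE.inner_eq_integral u y, ← h1]
  · intro k _
    exact hE.integrable_id (H.domain.add_mem u.2 (H.domain.smul_mem _ y.2))
  · exact E.integrable_indicator_mul hB hN

/-- By `inner_apply_proj`, on the bounded set `B` the measure (E(·)x, Hy) is ω times (E(·)x, y). -/
theorem integral_apply_indicator (y : H.domain) {B : Set ℝ} (hB : MeasurableSet B) {N : ℝ}
    (hN : ∀ ω ∈ B, |ω| ≤ N) (x : ℋ) {f : ℝ → ℂ} (hf : ∀ v, Integrable f (E.measure v)) :
    E.integral x (H y) (B.indicator f) =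
      E.integral x (y : ℋ) (B.indicator fun ω => ω * f ω) := by
  have hbd : ∀ ω, ‖B.indicator (fun ω : ℝ => (ω : ℂ)) ω‖ ≤ max N 1 := by
    intro ω
    by_cases hω : ω ∈ B
    · simpa [hω] using Or.inl (hN ω hω)
    · simp [hω]
  have hbd' : ∀ ω, ‖B.indicator (fun _ : ℝ => (1 : ℂ)) ω‖ ≤ max N 1 := fun ω =>
    (norm_indicator_le_norm_self _ _).trans (by simp)
  have := E.integral_eq_of_forall_indicator (x := x) (x' := x) (y := H y) (y' := y)
    (measurable_const.indicator hB) (Complex.measurable_ofReal.indicator hB) hbd' hbd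
    (fun C hC => by
      rw [indicator_indicator, indicator_indicator, E.integral_indicator_const (hC.inter hB),
        one_mul, hE.inner_apply_proj hH y (hC.inter hB) fun ω hω => hN ω hω.2])
    (f := f) (fun k _ => hf _) (fun k _ => hf _)
  convert this using 2 <;>
  · ext ω
    by_cases hω : ω ∈ B <;> simp [hω, mul_comm]

/-- `(f(H) x, H y) = ((ω f)(H) x, y)`. -/
theorem integral_apply (y : H.domain) (x : ℋ) {f : ℝ → ℂ}
    (hf : ∀ v, Integrable f (E.measure v))
    (hf' : ∀ v, Integrable (fun ω : ℝ => ω * f ω) (E.measure v)) :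
    E.integral x (H y) f = E.integral x (y : ℋ) (fun ω => ω * f ω) := by
  -- The identity is known on bounded sets; dominated convergence removes the truncation to [-n, n].
  have hlim : ∀ (v : ℋ) {g : ℝ → ℂ}, (∀ w, Integrable g (E.measure w)) →
      Tendsto (fun n : ℕ => E.integral x v ((Icc (-n : ℝ) n).indicator g)) atTop
        (𝓝 (E.integral x v g)) := by
    intro v g hg
    simp only [integral]
    refine Tendsto.const_mul _ (tendsto_finsetSum _ fun k _ => Tendsto.const_mul _ ?_)
    refine tendsto_integral_of_dominated_convergence (fun ω => ‖g ω‖)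
      (fun n => (hg _).aestronglyMeasurable.indicator measurableSet_Icc) (hg _).norm
      (fun n => ae_of_all _ fun ω => norm_indicator_le_norm_self _ _) (ae_of_all _ fun ω => ?_)
    refine tendsto_const_nhds.congr' ?_
    filter_upwards [eventually_ge_atTop ⌈|ω|⌉₊] with n hn
    have : |ω| ≤ n := (Nat.le_ceil _).trans (by exact_mod_cast hn)
    exact (indicator_of_mem (show ω ∈ Icc (-n : ℝ) n from abs_le.1 this) g).symm
  refine tendsto_nhds_unique (hlim (H y) hf) ?_
  simp only [hE.integral_apply_indicator hH y measurableSet_Icc (fun ω hω => abs_le.2 hω) x hf]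
  exact hlim y hf'

end IsSpectralMeasureOf

variable (E)

theorem integral_indicator_eq_of_density {x y : ℋ} {a b : ℝ} {q : ℝ → ℂ}
    (hq : ContinuousOn q (Icc a b))
    (h : ∀ B, MeasurableSet B → B ⊆ Icc a b → inner ℂ y (E.proj B x) = ∫ ω in B, q ω)
    {f : ℝ → ℂ} (hf : ∀ v, Integrable f (E.measure v)) (hf' : IntegrableOn f (Icc a b)) :
    E.integral x y ((Icc a b).indicator f) = ∫ ω in Icc a b, f ω * q ω := by
  classical
  obtain ⟨C, hC⟩ := isCompact_Icc.exists_bound_of_continuousOn hq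
  -- `none` carries Lebesgue measure on [a, b], `some k` the polarization measures; the density
  -- formula is then one linear relation among them.
  let m : Option ℕ → Measure ℝ := fun o =>
    o.elim (volume.restrict (Icc a b)) fun k => E.measure (x + Complex.I ^ k • y)
  have hm : ∀ o, IsFiniteMeasure (m o) := by
    rintro (_ | k)
    · exact inferInstanceAs (IsFiniteMeasure (volume.restrict (Icc a b)))
    · exact E.isFiniteMeasure_measure _
  have key := sum_integral_mul_eq_zero (Finset.insertNone (Finset.range 4)) m
    (h := ?_) (hf := ?_)
    (fun o => o.elim (fun ω => - (Icc a b).piecewise q 0 ω)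
      fun k => fun ω => (1 / 4 * Complex.I ^ k) * (Icc a b).indicator (fun _ => 1) ω)
    (hg := ?_) (C := fun o => o.elim (max C 0) fun k => 1) (hC := ?_) f
  · rw [Finset.sum_insertNone] at key
    simp only [m, Option.elim] at key
    have h1 : ∫ ω in Icc a b, f ω * -(Icc a b).piecewise q 0 ω =
        - ∫ ω in Icc a b, f ω * q ω := by
      rw [← integral_neg]
      refine setIntegral_congr_fun measurableSet_Icc fun ω hω => ?_
      simp [hω]
    have h2 : ∑ k ∈ Finset.range 4, ∫ ω, f ω * (1 / 4 * Complex.I ^ k *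
        (Icc a b).indicator (fun _ => 1) ω) ∂(E.measure (x + Complex.I ^ k • y)) =
        E.integral x y ((Icc a b).indicator f) := by
      rw [integral, Finset.mul_sum]
      refine Finset.sum_congr rfl fun k _ => ?_
      rw [← mul_assoc, ← MeasureTheory.integral_const_mul]
      congr 1
      ext ω
      by_cases hω : ω ∈ Icc a b <;> simp [hω, mul_comm]
    rw [h1, h2] at key
    linear_combination key
  · rintro (_ | k)
    · exact (hq.measurable_piecewise continuousOn_const measurableSet_Icc).neg
    · exact (measurable_const.indicator measurableSet_Icc).const_mul _
  · rintro (_ | k) ω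
    · by_cases hω : ω ∈ Icc a b
      · simpa [hω] using Or.inl (hC ω hω)
      · simp [hω]
    · by_cases hω : ω ∈ Icc a b
      · simp [hω]
        norm_num
      · simp [hω]
  · intro B hB
    rw [Finset.sum_insertNone]
    simp only [m, Option.elim]
    have hBI := hB.inter (measurableSet_Icc (a := a) (b := b))
    have h1 : ∫ ω in B, -(Icc a b).piecewise q 0 ω ∂(volume.restrict (Icc a b)) =
        - ∫ ω in B ∩ Icc a b, q ω := by
      rw [Measure.restrict_restrict hB, ← integral_neg]
      refine setIntegral_congr_fun hBI fun ω hω => ?_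
      simp [hω.2]
    rw [h1, ← h _ hBI inter_subset_right, ← E.setIntegral_one_polarization hBI, Finset.mul_sum,
      neg_add_eq_zero]
    refine Finset.sum_congr rfl fun k _ => ?_
    rw [MeasureTheory.integral_const_mul, ← mul_assoc, setIntegral_indicator measurableSet_Icc]
  · intro o ho
    rcases o with _ | k
    · exact hf'
    · exact hf _

end SpectralMeasure

/-! ### The continued density E[ψ, φ](z) -/

namespace Setting

variable {ℋ : Type*} [NormedAddCommGroup ℋ] [InnerProductSpace ℂ ℋ] [CompleteSpace ℋ]
variable {X : Type*} [AddCommGroup X] [Module ℂ X] [UniformSpace X]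
variable {S : Setting ℋ X}

theorem isOpen_I (S : Setting ℋ X) : IsOpen S.I := by
  rw [I, self_sdiff_frontier]
  exact isOpen_interior

theorem ofReal_mem_ΩI {x : ℝ} (hx : x ∈ S.I) : (x : ℂ) ∈ S.ΩI := Or.inr ⟨x, hx, rfl⟩

theorem continuousOn_ofReal {q : ℂ → ℂ} (hq : AnalyticOnNhd ℂ q S.ΩI) :
    ContinuousOn (fun ω : ℝ => q ω) S.I :=
  hq.continuousOn.comp Complex.continuous_ofReal.continuousOn fun _ hx => ofReal_mem_ΩI hx

theorem exists_Icc_subset_I {x : ℝ} (hx : x ∈ S.I) : ∃ a b, a < x ∧ x < b ∧ Icc a b ⊆ S.I := by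
  obtain ⟨ε, hε, h⟩ := Metric.nhds_basis_closedBall.mem_iff.1 (S.isOpen_I.mem_nhds hx)
  rw [Real.closedBall_eq_Icc] at h
  exact ⟨x - ε, x + ε, by linarith, by linarith, h⟩

theorem exists_isDensity (hS : S.Admissible) (ψ φ : X) : ∃ q, S.IsDensity ψ φ q := by
  choose q hq using fun k : ℕ => hS.density_exists (ψ + Complex.I ^ k • φ)
  refine ⟨fun z => (1 / 4 : ℂ) * ∑ k ∈ Finset.range 4, Complex.I ^ k * q k z, ?_, ?_, ?_⟩
  · exact analyticOnNhd_const.mul (Finset.analyticOnNhd_fun_sum _ fun k _ =>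
      analyticOnNhd_const.mul (hq k).1)
  · exact (integrable_finsetSum _ fun k _ => (hq k).2.1.const_mul _).const_mul _
  · intro B hB hBI
    have hint : ∀ k, IntegrableOn (fun ω : ℝ => Complex.I ^ k * q k ω) B :=
      fun k => ((hq k).2.1.mono_set hBI).const_mul _
    rw [integral_const_mul, integral_finsetSum _ fun k _ => hint k, ← S.E.inner_proj_proj hB,
      inner_eq_sum_norm_sq]
    congr 1
    refine Finset.sum_congr rfl fun k _ => ?_
    rw [integral_const_mul, ← (hq k).2.2 B hB hBI, ← S.E.inner_proj_proj hB,
      inner_self_eq_norm_sq_to_K, map_add, map_smul, map_add, map_smul]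
    norm_cast

theorem isDensity_density (hS : S.Admissible) (ψ φ : X) : S.IsDensity ψ φ (S.density ψ φ) := by
  have h := exists_isDensity hS ψ φ
  rw [density, dif_pos h]
  exact h.choose_spec

theorem analyticAt_density (hS : S.Admissible) (ψ φ : X) {z : ℂ} (hz : z ∈ S.Ω) :
    AnalyticAt ℂ (S.density ψ φ) z :=
  (isDensity_density hS ψ φ).1 z (Or.inl hz)

/-- The identity theorem on `Ω ∪ I`. -/
theorem eqOn_ΩI (hS : S.Admissible) {q₁ q₂ : ℂ → ℂ} (h₁ : AnalyticOnNhd ℂ q₁ S.ΩI)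
    (h₂ : AnalyticOnNhd ℂ q₂ S.ΩI) (h : ∀ x ∈ S.I, q₁ (x : ℂ) = q₂ x) : EqOn q₁ q₂ S.ΩI := by
  rintro z (hz | ⟨x, hx, rfl⟩)
  · obtain ⟨x, hx⟩ := hS.nonempty_I
    -- Analyticity at a real point holds in a full complex neighbourhood, so equality along I
    -- spreads there. That neighbourhood meets Ω, as x is in its closure, and Ω is connected.
    have hev : ∀ᶠ w in 𝓝 (x : ℂ), q₁ w = q₂ w := by
      rw [← (h₁ x (ofReal_mem_ΩI hx)).frequently_eq_iff_eventually_eq (h₂ x (ofReal_mem_ΩI hx))]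
      have ht : Tendsto (fun t : ℝ => (t : ℂ)) (𝓝[≠] x) (𝓝[≠] (x : ℂ)) :=
        Complex.continuous_ofReal.continuousAt.continuousWithinAt.tendsto_nhdsWithin
          fun t ht => by simpa using ht
      refine ht.frequently (Eventually.frequently ?_)
      filter_upwards [mem_nhdsWithin_of_mem_nhds (S.isOpen_I.mem_nhds hx)] with t ht using h t ht
    have hcl : (x : ℂ) ∈ closure S.Ω := hx.1
    obtain ⟨w, hw, hwΩ⟩ :=
      ((mem_closure_iff_frequently.1 hcl).and_eventually hev.eventually_nhds).exists
    exact AnalyticOnNhd.eqOn_of_preconnected_of_eventuallyEq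
      (fun z hz => h₁ z (Or.inl hz)) (fun z hz => h₂ z (Or.inl hz))
      hS.simplyConnected_Ω.isPathConnected.isConnected.isPreconnected hw hwΩ hz
  · exact h x hx

theorem eqOn_ΩI_of_setIntegral (hS : S.Admissible) {q₁ q₂ : ℂ → ℂ}
    (h₁ : AnalyticOnNhd ℂ q₁ S.ΩI) (h₂ : AnalyticOnNhd ℂ q₂ S.ΩI)
    (h : ∀ a b, Icc a b ⊆ S.I → ∀ B, MeasurableSet B → B ⊆ Icc a b →
      ∫ ω in B, q₁ (ω : ℂ) = ∫ ω in B, q₂ (ω : ℂ)) : EqOn q₁ q₂ S.ΩI := by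
  refine eqOn_ΩI hS h₁ h₂ fun x hx => ?_
  obtain ⟨a, b, hax, hxb, hab⟩ := exists_Icc_subset_I hx
  have hc₁ := (continuousOn_ofReal h₁).mono hab
  have hc₂ := (continuousOn_ofReal h₂).mono hab
  refine Measure.eqOn_Icc_of_ae_eq volume (hax.trans hxb).ne ?_ hc₁ hc₂ ⟨hax.le, hxb.le⟩
  refine Integrable.ae_eq_of_forall_setIntegral_eq _ _ hc₁.integrableOn_Icc
    hc₂.integrableOn_Icc fun B hB _ => ?_
  rw [Measure.restrict_restrict hB]
  exact h a b hab _ (hB.inter measurableSet_Icc) inter_subset_right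

theorem IsDensity.eqOn (hS : S.Admissible) {ψ φ : X} {q₁ q₂ : ℂ → ℂ} (h₁ : S.IsDensity ψ φ q₁)
    (h₂ : S.IsDensity ψ φ q₂) : EqOn q₁ q₂ S.ΩI :=
  eqOn_ΩI_of_setIntegral hS h₁.1 h₂.1 fun a b hab B hB hBab => by
    rw [← h₁.2.2 B hB (hBab.trans hab), ← h₂.2.2 B hB (hBab.trans hab)]

/-- The density is an arbitrary choice for each pair, so additivity comes only from uniqueness on Ω
∪ I. -/
theorem density_add_right (hS : S.Admissible) (ψ φ φ' : X) {z : ℂ} (hz : z ∈ S.ΩI) :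
    S.density ψ (φ + φ') z = S.density ψ φ z + S.density ψ φ' z := by
  have h := isDensity_density hS ψ φ
  have h' := isDensity_density hS ψ φ'
  refine (isDensity_density hS ψ (φ + φ')).eqOn hS
    (q₂ := fun z => S.density ψ φ z + S.density ψ φ' z)
    ⟨h.1.add h'.1, h.2.1.add h'.2.1, fun B hB hBI => ?_⟩ hz
  rw [integral_add (h.2.1.mono_set hBI) (h'.2.1.mono_set hBI), ← h.2.2 B hB hBI,
    ← h'.2.2 B hB hBI, map_add, inner_add_left]

theorem density_smul_right (hS : S.Admissible) (ψ φ : X) (c : ℂ) {z : ℂ} (hz : z ∈ S.ΩI) :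
    S.density ψ (c • φ) z = starRingEnd ℂ c * S.density ψ φ z := by
  have h := isDensity_density hS ψ φ
  refine (isDensity_density hS ψ (c • φ)).eqOn hS
    (q₂ := fun z => starRingEnd ℂ c * S.density ψ φ z)
    ⟨analyticOnNhd_const.mul h.1, h.2.1.const_mul _, fun B hB hBI => ?_⟩ hz
  rw [integral_const_mul, ← h.2.2 B hB hBI, map_smul, inner_smul_left]

/-- `E[ψ, H φ](z) = z E[ψ, φ](z)`. -/
theorem density_apply (hS : S.Admissible) (ψ : X) {y x : X} (h : (S.ι y, S.ι x) ∈ S.H.graph)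
    {z : ℂ} (hz : z ∈ S.ΩI) : S.density ψ x z = z * S.density ψ y z := by
  obtain ⟨y', hy', hx⟩ := (LinearPMap.mem_graph_iff _).1 h
  simp only at hy' hx
  have hy := isDensity_density hS ψ y
  have hdx := isDensity_density hS ψ x
  refine eqOn_ΩI_of_setIntegral hS (q₂ := fun z => z * S.density ψ y z) hdx.1
    (analyticOnNhd_id.mul hy.1) (fun a b hab B hB hBab => ?_) hz
  obtain ⟨N, hN⟩ := isCompact_Icc.exists_bound_of_continuousOn
    (continuous_id.continuousOn (s := Icc a b))
  have hN' : ∀ ω ∈ B, |ω| ≤ N := fun ω hω => hN ω (hBab hω)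
  rw [← hdx.2.2 B hB (hBab.trans hab), ← hx,
    hS.spectral_E.inner_apply_proj hS.selfAdjoint_H y' hB hN', hy']
  have hind : (Icc a b).indicator (B.indicator fun ω : ℝ => (ω : ℂ)) =
      B.indicator fun ω : ℝ => (ω : ℂ) := by
    rw [indicator_indicator, inter_eq_right.2 hBab]
  have hint : IntegrableOn (B.indicator fun ω : ℝ => (ω : ℂ)) (Icc a b) :=
    (Complex.continuous_ofReal.continuousOn.integrableOn_Icc).indicator hB
  have := S.E.integral_indicator_eq_of_density ((continuousOn_ofReal hy.1).mono hab)
    (fun C hC hCab => hy.2.2 C hC (hCab.trans hab)) (S.E.integrable_indicator_mul hB hN') hint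
  rw [hind] at this
  rw [this]
  conv_rhs => rw [← inter_eq_right.2 hBab, ← setIntegral_indicator hB]
  refine setIntegral_congr_fun measurableSet_Icc fun ω _ => ?_
  by_cases hω : ω ∈ B <;> simp [hω]

variable [IsUniformAddGroup X] [ContinuousSMul ℂ X] [BarrelledSpace ℂ X]

/-- Banach–Steinhaus: on a barrelled space a pointwise limit of continuous functionals along a
countably generated filter is continuous. -/
theorem exists_antiDual_of_tendsto {α : Type*} {l : Filter α} [l.IsCountablyGenerated] [l.NeBot]
    (g : α → AntiDual X) {f : X → ℂ} (h : ∀ φ, Tendsto (fun a => g a φ) l (𝓝 (f φ))) :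
    ∃ ν : AntiDual X, ∀ φ, ν φ = f φ :=
  ⟨continuousLinearMapOfTendsto g (tendsto_pi_nhds.2 h), fun _ => rfl⟩

theorem exists_iteratedDeriv_density (hS : S.Admissible) (ψ : X) (n : ℕ) :
    ∀ z ∈ S.Ω, ∃ ν : AntiDual X, ∀ φ, ν φ = iteratedDeriv n (S.density ψ φ) z := by
  induction n with
  | zero =>
    intro z hz
    exact ⟨⟨⟨⟨fun φ => S.density ψ φ z, fun φ φ' => density_add_right hS ψ φ φ' (Or.inl hz)⟩,
      fun c φ => density_smul_right hS ψ φ c (Or.inl hz)⟩,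
      hS.density_continuous_right z (Or.inl hz) ψ⟩, fun φ => by simp⟩
  | succ n ih =>
    intro z hz
    choose! D hD using ih
    have hΩ := hS.isOpen_Ω
    -- The next derivative is the pointwise limit of difference quotients, which are continuous
    -- functionals by induction.
    refine exists_antiDual_of_tendsto (l := 𝓝[≠] z)
      (fun w => (w - z)⁻¹ • (D w - D z)) fun φ => ?_
    have han : AnalyticAt ℂ (iteratedDeriv n (S.density ψ φ)) z := by
      rw [iteratedDeriv_eq_iterate]
      exact (analyticAt_density hS ψ φ hz).iterated_deriv n
    rw [iteratedDeriv_succ]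
    refine han.differentiableAt.hasDerivAt.tendsto_slope.congr' ?_
    filter_upwards [mem_nhdsWithin_of_mem_nhds (hΩ.mem_nhds hz)] with w hw
    simp [slope_def_field, hD w hw, hD z hz, div_eq_inv_mul]

end Setting

/-! ### Powers of the resolvent and their boundary values -/

theorem norm_one_div_pow_le {w : ℂ} {c : ℝ} (hc : 0 < c) (hw : c ≤ |w.im|) (n : ℕ) (ω : ℝ) :
    ‖1 / (w - ω) ^ n‖ ≤ 1 / c ^ n := by
  have h : c ≤ ‖w - ω‖ := hw.trans (by simpa using Complex.abs_im_le_norm (w - ω))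
  rw [norm_div, norm_one, norm_pow]
  gcongr

theorem measurable_one_div_pow (w : ℂ) (n : ℕ) : Measurable fun ω : ℝ => 1 / (w - ω) ^ n := by
  fun_prop

theorem sub_ofReal_ne_zero {w : ℂ} (hw : w.im ≠ 0) (ω : ℝ) : w - ω ≠ 0 := fun h => by
  have := congrArg Complex.im h
  simp at this
  exact hw this

namespace SpectralMeasure

variable {ℋ : Type*} [NormedAddCommGroup ℋ] [InnerProductSpace ℂ ℋ] [CompleteSpace ℋ]
variable (E : SpectralMeasure ℋ)

theorem integrable_one_div_pow {w : ℂ} (hw : w.im ≠ 0) (n : ℕ) (v : ℋ) :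
    Integrable (fun ω : ℝ => 1 / (w - ω) ^ n) (E.measure v) :=
  E.integrable_of_bounded (measurable_one_div_pow w n)
    (norm_one_div_pow_le (abs_pos.2 hw) le_rfl n) v

/-- `(w - H) (w - H)⁻ⁿ⁻¹ = (w - H)⁻ⁿ`. -/
theorem IsSpectralMeasureOf.integral_one_div_pow_apply {H : ℋ →ₗ.[ℂ] ℋ} {E : SpectralMeasure ℋ}
    (hE : E.IsSpectralMeasureOf H) (hH : IsSelfAdjoint H) (y : H.domain) (x : ℋ) {w : ℂ}
    (hw : w.im ≠ 0) (n : ℕ) :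
    E.integral x (H y) (fun ω => 1 / (w - ω) ^ (n + 1)) =
      w * E.integral x (y : ℋ) (fun ω => 1 / (w - ω) ^ (n + 1)) -
        E.integral x (y : ℋ) (fun ω => 1 / (w - ω) ^ n) := by
  have hfun : (fun ω : ℝ => (ω : ℂ) * (1 / (w - ω) ^ (n + 1))) =
      fun ω : ℝ => w * (1 / (w - ω) ^ (n + 1)) + (-1) * (1 / (w - ω) ^ n) := by
    ext ω
    have := sub_ofReal_ne_zero hw ω
    field_simp
    ring
  have h₁ := fun v : ℋ => (E.integrable_one_div_pow hw (n + 1) v).const_mul w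
  have h₂ := fun v : ℋ => (E.integrable_one_div_pow hw n v).const_mul (-1)
  rw [hE.integral_apply hH y x (E.integrable_one_div_pow hw (n + 1))
    (fun v => by rw [hfun]; exact (h₁ v).add (h₂ v)), hfun,
    E.integral_add_fun (fun _ _ => h₁ _) (fun _ _ => h₂ _), E.integral_const_mul,
    E.integral_const_mul]
  ring

theorem hasDerivAt_integral_one_div_pow (x y : ℋ) (a : ℝ) (n : ℕ) {t : ℝ} (ht : t < 0) :
    HasDerivAt (fun t : ℝ => E.integral x y fun ω => 1 / ((a : ℂ) + Complex.I * t - ω) ^ (n + 1))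
      (-((n : ℂ) + 1) * Complex.I *
        E.integral x y fun ω => 1 / ((a : ℂ) + Complex.I * t - ω) ^ (n + 2)) t := by
  have him : ∀ s : ℝ, ((a : ℂ) + Complex.I * s).im = s := fun s => by simp
  -- Within distance -t/2 of t the points a + is stay at least -t/2 from the real axis, which gives
  -- a constant dominating function.
  have hc : 0 < -t / 2 := by linarith
  have hs : ∀ s ∈ Metric.ball t (-t / 2), -t / 2 ≤ |((a : ℂ) + Complex.I * s).im| := by
    intro s hs
    rw [him]
    rw [Metric.mem_ball, Real.dist_eq, abs_lt] at hs
    rw [abs_of_neg (by linarith)]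
    linarith
  have key : ∀ v : ℋ, HasDerivAt
      (fun t : ℝ => ∫ ω : ℝ, 1 / ((a : ℂ) + Complex.I * t - ω) ^ (n + 1) ∂(E.measure v))
      (-((n : ℂ) + 1) * Complex.I *
        ∫ ω : ℝ, 1 / ((a : ℂ) + Complex.I * t - ω) ^ (n + 2) ∂(E.measure v)) t := by
    intro v
    rw [← MeasureTheory.integral_const_mul]
    refine (hasDerivAt_integral_of_dominated_loc_of_deriv_le
      (F := fun (t : ℝ) (ω : ℝ) => 1 / ((a : ℂ) + Complex.I * t - ω) ^ (n + 1))
      (F' := fun (t : ℝ) (ω : ℝ) => -((n : ℂ) + 1) * Complex.I *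
        (1 / ((a : ℂ) + Complex.I * t - ω) ^ (n + 2)))
      (bound := fun _ => ‖-((n : ℂ) + 1) * Complex.I‖ * (1 / (-t / 2) ^ (n + 2)))
      (Metric.ball_mem_nhds t hc) ?_ ?_ ?_ ?_ (integrable_const _) ?_).2
    · exact Eventually.of_forall fun s => (measurable_one_div_pow _ _).aestronglyMeasurable
    · exact E.integrable_one_div_pow (by rw [him]; exact ht.ne) _ v
    · exact ((measurable_one_div_pow _ _).const_mul _).aestronglyMeasurable
    · refine ae_of_all _ fun ω s h => ?_
      rw [norm_mul]
      exact mul_le_mul_of_nonneg_left (norm_one_div_pow_le hc (hs s h) _ _) (norm_nonneg _)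
    · refine ae_of_all _ fun ω s h => ?_
      have hne : (a : ℂ) + Complex.I * s - ω ≠ 0 := by
        refine sub_ofReal_ne_zero (fun h0 => ?_) ω
        have := hs s h
        rw [h0, abs_zero] at this
        linarith
      have h1 : HasDerivAt (fun s : ℝ => (a : ℂ) + Complex.I * s - ω) Complex.I s := by
        simpa using (((Complex.ofRealCLM.hasDerivAt (x := s)).const_mul Complex.I).const_add
          (a : ℂ)).sub_const (ω : ℂ)
      have h2 := (h1.fun_pow (n + 1)).fun_inv (pow_ne_zero _ hne)
      simp only [one_div]
      refine h2.congr_deriv ?_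
      rw [Nat.add_sub_cancel]
      push_cast
      field_simp
      ring
  simp only [integral, Finset.mul_sum]
  refine HasDerivAt.fun_sum fun k _ => ?_
  refine (((key (x + Complex.I ^ k • y)).const_mul (Complex.I ^ k)).const_mul
    (1 / 4 : ℂ)).congr_deriv ?_
  ring

/-- If `(a + i t - H)⁻ⁿ⁻²` has weak limits for `t → 0-`, then so has `(a + i t - H)⁻ⁿ⁻¹`. -/
theorem exists_tendsto_integral_one_div_pow (x y : ℋ) (a : ℝ) (n : ℕ) {L : ℂ}
    (hL : Tendsto (fun t : ℝ => E.integral x y fun ω => 1 / ((a : ℂ) + Complex.I * t - ω) ^ (n + 2))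
      (𝓝[<] 0) (𝓝 L)) :
    ∃ L', Tendsto
      (fun t : ℝ => E.integral x y fun ω => 1 / ((a : ℂ) + Complex.I * t - ω) ^ (n + 1))
      (𝓝[<] 0) (𝓝 L') := by
  -- Up to a constant, the convergent power is the derivative of the lower one. It is bounded near
  -- 0, so the lower power is Lipschitz there and maps the filter at 0- to a Cauchy filter.
  have hev := hL.norm.eventually (gt_mem_nhds (lt_add_one ‖L‖))
  obtain ⟨δ, hδ, hbd⟩ := mem_nhdsLT_iff_exists_Ioo_subset.1 hev
  have hlip := (convex_Ioo δ (0 : ℝ)).lipschitzOnWith_of_nnnorm_hasDerivWithin_le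
    (C := ‖-((n : ℂ) + 1) * Complex.I‖₊ * (‖L‖₊ + 1))
    (fun t ht => (E.hasDerivAt_integral_one_div_pow x y a n ht.2).hasDerivWithinAt)
    (fun t ht => by
      rw [nnnorm_mul]
      gcongr
      exact (hbd ht).le)
  exact cauchy_map_iff_exists_tendsto.1
    ((cauchy_nhds.mono nhdsWithin_le_nhds).map_of_le hlip.uniformContinuousOn
      (le_principal_iff.2 (Ioo_mem_nhdsLT hδ)))

end SpectralMeasure

theorem iteratedDeriv_id_mul {U : Set ℂ} (hU : IsOpen U) {g : ℂ → ℂ} (hg : AnalyticOnNhd ℂ g U)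
    (n : ℕ) : ∀ z ∈ U, iteratedDeriv (n + 1) (fun w => w * g w) z =
      z * iteratedDeriv (n + 1) g z + (n + 1) * iteratedDeriv n g z := by
  have hd : ∀ n, ∀ z ∈ U, HasDerivAt (iteratedDeriv n g) (iteratedDeriv (n + 1) g z) z := by
    intro n z hz
    rw [iteratedDeriv_succ]
    rw [iteratedDeriv_eq_iterate]
    exact ((hg z hz).iterated_deriv n).differentiableAt.hasDerivAt
  induction n with
  | zero =>
    intro z hz
    have h0 := hd 0 z hz
    simp only [zero_add, iteratedDeriv_zero] at h0
    rw [zero_add, iteratedDeriv_one, ((hasDerivAt_id' z).fun_mul h0).deriv]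
    simp [add_comm]
  | succ n ih =>
    intro z hz
    rw [iteratedDeriv_succ]
    have hev : iteratedDeriv (n + 1) (fun w => w * g w) =ᶠ[𝓝 z]
        fun z => z * iteratedDeriv (n + 1) g z + (n + 1) * iteratedDeriv n g z := by
      filter_upwards [hU.mem_nhds hz] with w hw using ih w hw
    rw [hev.deriv_eq, (((hasDerivAt_id' z).fun_mul (hd (n + 1) z hz)).fun_add
      ((hd n z hz).const_mul _)).deriv]
    push_cast
    ring

/-! ### The operators A^(n)(z) and powers of z - H^× -/

namespace Setting

variable {ℋ : Type*} [NormedAddCommGroup ℋ] [InnerProductSpace ℂ ℋ] [CompleteSpace ℋ]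
variable {X : Type*} [AddCommGroup X] [Module ℂ X] [UniformSpace X]
variable {S : Setting ℋ X}

theorem scalarSub_Hx_iff (hS : S.Admissible) {z : ℂ} {ν ν' : AntiDual X} :
    scalarSub z S.Hx ν ν' ↔
      ∀ y ∈ S.Y, ∀ x, (S.ι y, S.ι x) ∈ S.H.graph → ν' y = z * ν y - ν x := by
  rw [scalarSub, Hx, LinearPMap.isSelfAdjoint_def.1 hS.selfAdjoint_H]
  constructor
  · rintro ⟨κ, hκ, rfl⟩ y hy x hx
    simp [hκ y hy x hx]
  · intro h
    refine ⟨z • ν - ν', fun y hy x hx => ?_, by abel⟩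
    simp [h y hy x hx]

theorem exists_antiDual_resolvent (S : Setting ℋ X) {w : ℂ} (hw : w.im ≠ 0) (n : ℕ) (ψ : X) :
    ∃ ν : AntiDual X, ∀ φ, ν φ = S.E.integral (S.ι ψ) (S.ι φ) (fun ω => 1 / (w - ω) ^ n) := by
  obtain ⟨Λ, hΛ⟩ := S.E.exists_antilinear (measurable_one_div_pow w n)
    (norm_one_div_pow_le (abs_pos.2 hw) le_rfl n) (S.ι ψ)
  exact ⟨Λ.comp S.ι, fun φ => hΛ _⟩

theorem resolvent_apply (hS : S.Admissible) {w : ℂ} (hw : w.im ≠ 0) (n : ℕ) (ψ : X) {y x : X}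
    (h : (S.ι y, S.ι x) ∈ S.H.graph) :
    S.E.integral (S.ι ψ) (S.ι x) (fun ω => 1 / (w - ω) ^ (n + 1)) =
      w * S.E.integral (S.ι ψ) (S.ι y) (fun ω => 1 / (w - ω) ^ (n + 1)) -
        S.E.integral (S.ι ψ) (S.ι y) (fun ω => 1 / (w - ω) ^ n) := by
  obtain ⟨y', hy', hx⟩ := (LinearPMap.mem_graph_iff _).1 h
  simp only at hy' hx
  rw [← hy', ← hx]
  exact hS.spectral_E.integral_one_div_pow_apply hS.selfAdjoint_H y' _ hw n

theorem mem_Ωhat_cases {z : ℂ} (hz : z ∈ S.Ωhat) :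
    z ∈ S.Ω ∨ (∃ x ∈ S.I, z = x) ∨ z.im < 0 := by
  rcases hz with (hz | ⟨x, hx, rfl⟩) | hz
  · exact Or.inl hz
  · exact Or.inr (Or.inl ⟨x, hx, rfl⟩)
  · exact Or.inr (Or.inr hz)

theorem tendsto_ofReal_add_I_mul (x : ℝ) :
    Tendsto (fun t : ℝ => (x : ℂ) + Complex.I * t) (𝓝[<] 0) (𝓝 (x : ℂ)) := by
  have : Continuous fun t : ℝ => (x : ℂ) + Complex.I * t := by fun_prop
  simpa using (this.tendsto 0).mono_left nhdsWithin_le_nhds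

/-- `(z - H^×) A⁽¹⁾(z) i ψ = i ψ`. -/
theorem IsA.scalarSub_one (hS : S.Admissible) {z : ℂ} (hz : z ∈ S.Ωhat) {ψ : X}
    {ν : AntiDual X} (h : S.IsA 1 z ψ ν) : scalarSub z S.Hx ν (S.incl ψ) := by
  rw [scalarSub_Hx_iff hS]
  intro y hy x hx
  have h0 : ∀ w : ℂ, S.E.integral (S.ι ψ) (S.ι y) (fun ω => 1 / (w - ω) ^ 0) = S.incl ψ y := by
    intro w
    simp only [pow_zero, div_one, S.E.integral_one]
    rfl
  have hres : ∀ {w : ℂ}, w.im ≠ 0 → _ := fun {w} hw => resolvent_apply hS hw 0 ψ hx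
  simp only [h0] at hres
  rcases mem_Ωhat_cases hz with hz | ⟨a, ha, rfl⟩ | hz
  · rw [(h y).1 hz, (h x).1 hz, hres (hS.im_pos_Ω z hz).ne']
    simp only [Nat.sub_self, iteratedDeriv_zero, density_apply hS ψ hx (Or.inl hz)]
    ring
  · have hy' := (h y).2.1 a ha rfl
    have hx' := (h x).2.1 a ha rfl
    refine tendsto_nhds_unique ?_ (((tendsto_ofReal_add_I_mul a).mul hy').sub hx')
    refine tendsto_const_nhds.congr' ?_
    filter_upwards [self_mem_nhdsWithin] with t ht
    rw [hres (by simpa using (show t < 0 from ht).ne)]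
    ring
  · rw [(h y).2.2 hz, (h x).2.2 hz, hres hz.ne]
    ring

/-- Only the top order is given to lie in X'. On Ω continuity of the lower order comes from
`exists_iteratedDeriv_density`; on I the scalar limits exist by
`exists_tendsto_integral_one_div_pow`, and Banach–Steinhaus makes them a continuous functional;
below the axis the resolvent is bounded. -/
theorem IsA.exists_pred [IsUniformAddGroup X] [ContinuousSMul ℂ X]
    [BarrelledSpace ℂ X] (hS : S.Admissible) {z : ℂ} (hz : z ∈ S.Ωhat) {n : ℕ} {ψ : X}
    {ν : AntiDual X} (h : S.IsA (n + 2) z ψ ν) : ∃ ν', S.IsA (n + 1) z ψ ν' := by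
  rcases mem_Ωhat_cases hz with hz | ⟨a, ha, rfl⟩ | hz
  · have him := hS.im_pos_Ω z hz
    obtain ⟨ν₁, h₁⟩ := S.exists_antiDual_resolvent him.ne' (n + 1) ψ
    obtain ⟨ν₂, h₂⟩ := exists_iteratedDeriv_density hS ψ n z hz
    refine ⟨ν₁ + (2 * Real.pi * Complex.I * ((-1) ^ n / n.factorial)) • ν₂,
      fun φ => ⟨fun _ => ?_, fun x _ hzx => ?_, fun hneg => ?_⟩⟩
    · simp [h₁, h₂]
    · rw [hzx, Complex.ofReal_im] at him
      exact absurd him (lt_irrefl _)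
    · exact absurd hneg him.not_gt
  · choose f hf using fun φ => S.E.exists_tendsto_integral_one_div_pow _ _ a n ((h φ).2.1 a ha rfl)
    choose! g hg using fun (t : ℝ) (ht : t < 0) =>
      S.exists_antiDual_resolvent (w := (a : ℂ) + Complex.I * t) (by simpa using ht.ne) (n + 1) ψ
    obtain ⟨ν', h'⟩ := exists_antiDual_of_tendsto (l := 𝓝[<] (0 : ℝ)) g (f := f) fun φ => by
      refine (hf φ).congr' ?_
      filter_upwards [self_mem_nhdsWithin] with t ht using (hg t ht φ).symm
    refine ⟨ν', fun φ => ⟨fun haΩ => ?_, fun x _ hax => ?_, fun hneg => ?_⟩⟩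
    · simpa using hS.im_pos_Ω _ haΩ
    · rw [h', ← Complex.ofReal_injective hax]
      exact hf φ
    · simp at hneg
  · obtain ⟨ν', h'⟩ := S.exists_antiDual_resolvent hz.ne (n + 1) ψ
    refine ⟨ν', fun φ => ⟨fun hzΩ => ?_, fun x _ hzx => ?_, fun _ => h' φ⟩⟩
    · exact absurd (hS.im_pos_Ω z hzΩ) hz.not_gt
    · rw [hzx, Complex.ofReal_im] at hz
      exact absurd hz (lt_irrefl _)

/-- `(z - H^×) A⁽ⁿ⁺²⁾(z) i ψ = A⁽ⁿ⁺¹⁾(z) i ψ`. -/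
theorem IsA.scalarSub_succ (hS : S.Admissible) {z : ℂ} (hz : z ∈ S.Ωhat) {n : ℕ} {ψ : X}
    {ν ν' : AntiDual X} (h : S.IsA (n + 2) z ψ ν) (h' : S.IsA (n + 1) z ψ ν') :
    scalarSub z S.Hx ν ν' := by
  rw [scalarSub_Hx_iff hS]
  intro y hy x hx
  have hres : ∀ {w : ℂ}, w.im ≠ 0 → _ := fun {w} hw => resolvent_apply hS hw (n + 1) ψ hx
  rcases mem_Ωhat_cases hz with hz | ⟨a, ha, rfl⟩ | hz
  · have heq : EqOn (S.density ψ x) (fun w => w * S.density ψ y w) S.Ω :=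
      fun w hw => density_apply hS ψ hx (Or.inl hw)
    rw [(h y).1 hz, (h x).1 hz, (h' y).1 hz, hres (hS.im_pos_Ω z hz).ne']
    simp only [show n + 2 - 1 = n + 1 from rfl, show n + 1 - 1 = n from rfl]
    -- The Leibniz term (n+1)·∂ⁿ with coefficient (-1)ⁿ⁺¹/(n+1)! enters with a minus sign and leaves
    -- (-1)ⁿ/n!, the coefficient of the lower order.
    rw [heq.iteratedDeriv_of_isOpen hS.isOpen_Ω (n + 1) hz, iteratedDeriv_id_mul hS.isOpen_Ω
      (fun w hw => analyticAt_density hS ψ y hw) n z hz, Nat.factorial_succ]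
    have hn : (n.factorial : ℂ) ≠ 0 := by exact_mod_cast n.factorial_ne_zero
    have hn' : (n : ℂ) + 1 ≠ 0 := by exact_mod_cast n.succ_ne_zero
    push_cast
    field_simp
    ring
  · have hy' := (h y).2.1 a ha rfl
    have hx' := (h x).2.1 a ha rfl
    refine tendsto_nhds_unique ((h' y).2.1 a ha rfl)
      ((((tendsto_ofReal_add_I_mul a).mul hy').sub hx').congr' ?_)
    filter_upwards [self_mem_nhdsWithin] with t ht
    rw [hres (by simpa using (show t < 0 from ht).ne)]
    ring
  · rw [(h y).2.2 hz, (h x).2.2 hz, (h' y).2.2 hz, hres hz.ne]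
    ring

/-- `(z - H^×)ⁿ⁺¹ A⁽ⁿ⁺¹⁾(z) i ψ = i ψ`. -/
theorem IsA.opPow [IsUniformAddGroup X] [ContinuousSMul ℂ X]
    [BarrelledSpace ℂ X] (hS : S.Admissible) {z : ℂ} (hz : z ∈ S.Ωhat) {n : ℕ} {ψ : X}
    {ν : AntiDual X} (h : S.IsA (n + 1) z ψ ν) :
    GelfandTriplet.opPow (scalarSub z S.Hx) (n + 1) ν (S.incl ψ) := by
  have key : ∀ j m : ℕ, j + m = n →
      ∃ ν', GelfandTriplet.opPow (scalarSub z S.Hx) j ν ν' ∧ S.IsA (m + 1) z ψ ν' := by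
    intro j
    induction j with
    | zero =>
      rintro m hm
      rw [zero_add] at hm
      exact ⟨ν, rfl, hm ▸ h⟩
    | succ j ih =>
      intro m hm
      obtain ⟨ν₁, hν₁, hA₁⟩ := ih (m + 1) (by omega)
      obtain ⟨ν₂, hA₂⟩ := hA₁.exists_pred hS hz
      exact ⟨ν₂, ⟨ν₁, hν₁, hA₁.scalarSub_succ hS hz hA₂⟩, hA₂⟩
  obtain ⟨ν', hν', hA⟩ := key n 0 rfl
  exact ⟨ν', hν', hA.scalarSub_one hS hz⟩

theorem scalarSub_Hx_add (hS : S.Admissible) {z : ℂ} {μ μ' ν ν' : AntiDual X}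
    (h : scalarSub z S.Hx μ ν) (h' : scalarSub z S.Hx μ' ν') :
    scalarSub z S.Hx (μ + μ') (ν + ν') := by
  rw [scalarSub_Hx_iff hS] at *
  intro y hy x hx
  simp only [add_apply, h y hy x hx, h' y hy x hx]
  ring

theorem opPow_scalarSub_Hx_add (hS : S.Admissible) {z : ℂ} (n : ℕ) :
    ∀ {μ μ' ν ν' : AntiDual X}, opPow (scalarSub z S.Hx) n μ ν → opPow (scalarSub z S.Hx) n μ' ν' →
      opPow (scalarSub z S.Hx) n (μ + μ') (ν + ν') := by
  induction n with
  | zero =>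
    rintro _ _ _ _ rfl rfl
    rfl
  | succ n ih =>
    rintro _ _ _ _ ⟨ξ, h₁, h₂⟩ ⟨ξ', h₁', h₂'⟩
    exact ⟨ξ + ξ', ih h₁ h₁', scalarSub_Hx_add hS h₂ h₂'⟩

theorem opPow_scalarSub_Hx_zero (hS : S.Admissible) {z : ℂ} (n : ℕ) :
    opPow (scalarSub z S.Hx) n (0 : AntiDual X) 0 := by
  induction n with
  | zero => rfl
  | succ n ih =>
    refine ⟨0, ih, ?_⟩
    rw [scalarSub_Hx_iff hS]
    simp

/-- Operators are relations here, so single-valuedness needs proof: the value is fixed on the dense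
`Y` because HY ⊂ X. -/
theorem scalarSub_Hx_unique (hS : S.Admissible) {z : ℂ} {μ ν ν' : AntiDual X}
    (h : scalarSub z S.Hx μ ν) (h' : scalarSub z S.Hx μ ν') : ν = ν' := by
  rw [scalarSub_Hx_iff hS] at h h'
  refine ContinuousLinearMap.coeFn_injective
    (Continuous.ext_on hS.dense_Y ν.continuous ν'.continuous fun y hy => ?_)
  obtain ⟨x, hx⟩ := hS.map_H y hy
  rw [h y hy x hx, h' y hy x hx]

theorem opPow_scalarSub_Hx_unique (hS : S.Admissible) {z : ℂ} (n : ℕ) :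
    ∀ {μ ν ν' : AntiDual X}, opPow (scalarSub z S.Hx) n μ ν → opPow (scalarSub z S.Hx) n μ ν' →
      ν = ν' := by
  induction n with
  | zero =>
    rintro _ _ _ rfl rfl
    rfl
  | succ n ih =>
    rintro _ _ _ ⟨ξ, h₁, h₂⟩ ⟨ξ', h₁', h₂'⟩
    obtain rfl := ih h₁ h₁'
    exact scalarSub_Hx_unique hS h₂ h₂'

/-! ### Passage from H^× to T^× -/

/-- `T^× = H^× + K^×` on `D(H^×) ∩ D(K^×)`. -/
theorem Tx_add (hS : S.Admissible) {μ κ κ' : AntiDual X} (hH : S.Hx μ κ) (hK : S.Kx μ κ') :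
    S.Tx μ (κ + κ') := by
  refine ⟨fun y hy x hx => ?_, ⟨κ, hH⟩, ⟨κ', hK⟩⟩
  have hHs : S.H† = S.H := LinearPMap.isSelfAdjoint_def.1 hS.selfAdjoint_H
  obtain ⟨x₁, hx₁⟩ := hS.map_H y hy
  obtain ⟨x₂, hx₂⟩ := hS.map_K y hy
  rw [← hHs] at hx₁
  have hdom : S.T.domain = S.H.domain := inf_eq_left.2 hS.domain_le
  have hT : Dense (S.T.domain : Set ℋ) := hdom ▸ hS.dense_H
  -- T^*y = H^*y + K^*y, tested against D(T) = D(H), which is dense and contained in D(K).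
  have hxx : S.ι x = S.ι x₁ + S.ι x₂ := by
    have hadj := LinearPMap.adjoint_isFormalAdjoint hT
    have hadjH := LinearPMap.adjoint_isFormalAdjoint hS.dense_H
    have hadjK := LinearPMap.adjoint_isFormalAdjoint hS.dense_K
    obtain ⟨u, hu, hux⟩ := (LinearPMap.mem_graph_iff _).1 hx
    obtain ⟨u₁, hu₁, hux₁⟩ := (LinearPMap.mem_graph_iff _).1 hx₁
    obtain ⟨u₂, hu₂, hux₂⟩ := (LinearPMap.mem_graph_iff _).1 hx₂
    simp only at hu hux hu₁ hux₁ hu₂ hux₂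
    refine hT.eq_of_inner_left (𝕜 := ℂ) fun v hv => ?_
    have hvH : v ∈ S.H.domain := hdom ▸ hv
    have e := hadj u ⟨v, hv⟩
    have e₁ := hadjH u₁ ⟨v, hvH⟩
    have e₂ := hadjK u₂ ⟨v, hS.domain_le hvH⟩
    rw [hux, hu] at e
    rw [hux₁, hu₁] at e₁
    rw [hux₂, hu₂] at e₂
    have hTv : S.T ⟨v, hv⟩ = S.H ⟨v, hvH⟩ + S.K ⟨v, hS.domain_le hvH⟩ := rfl
    rw [hTv, inner_add_right] at e
    rw [inner_add_left, e₁, e₂]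
    exact e
  have hx' : x = x₁ + x₂ := hS.injective_ι (by rw [hxx, map_add])
  rw [hx', map_add, add_apply, hH y hy x₁ hx₁, hK y hy x₂ hx₂]

/-- `(z - H^×)ᵐ B⁽ᵐ⁾(z) ⋯ B⁽¹⁾(z) ⊆ (z - T^×)ᵐ`. -/
theorem opPow_scalarSub_Tx_of_Bcomp [IsUniformAddGroup X] [ContinuousSMul ℂ X]
    [BarrelledSpace ℂ X] (hS : S.Admissible) {z : ℂ} (hz : z ∈ S.Ωhat) (m : ℕ) :
    ∀ {μ ξ η : AntiDual X}, S.Bcomp z m μ ξ → opPow (scalarSub z S.Hx) m ξ η →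
      opPow (scalarSub z S.Tx) m μ η := by
  induction m with
  | zero =>
    rintro μ ξ η rfl h
    exact h
  | succ m ih =>
    rintro μ ξ η ⟨ξ', hcomp, ζ, ψ, α, hζ, hK, hA, rfl⟩ hη
    -- With ξ = ξ' - α, both ξ and α lie in the domain of (z - H^×)^(m+1), hence so does ξ' = ξ + α,
    -- with image η + iψ.
    have hsum := opPow_scalarSub_Hx_add hS (m + 1) hη (hA.opPow hS hz)
    rw [sub_add_cancel] at hsum
    obtain ⟨ζ', hζ', κ, hκ, hηκ⟩ := hsum
    obtain rfl := opPow_scalarSub_Hx_unique hS m hζ hζ'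
    -- Here κ = H^×ζ and iψ = K^×ζ, so η = zζ - κ - iψ is (z - T^×)ζ.
    refine ⟨ζ, ih hcomp hζ, κ + S.incl ψ, Tx_add hS hκ hK, ?_⟩
    rw [← sub_sub, ← hηκ, add_sub_cancel_right]

end Setting

end GelfandTriplet

theorem theorem3p9 {ℋ : Type*} [NormedAddCommGroup ℋ] [InnerProductSpace ℂ ℋ] [CompleteSpace ℋ]
    {X : Type*} [AddCommGroup X] [Module ℂ X] [UniformSpace X] [IsUniformAddGroup X]
    [ContinuousSMul ℂ X] [LocallyConvexSpace ℝ X] [T2Space X]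
    (S : GelfandTriplet.Setting ℋ X) (hS : S.Admissible)
    (z : ℂ) (hz : S.IsGeneralizedEigenvalue z)
    (μ : GelfandTriplet.AntiDual X) (hμ : μ ∈ S.genEigenspace z) :
    ∃ M : ℕ, GelfandTriplet.opPow (GelfandTriplet.scalarSub z S.Tx) M μ 0 := by
  obtain ⟨m, _, hm⟩ := hμ
  have := hS.barrelled
  exact ⟨m, GelfandTriplet.Setting.opPow_scalarSub_Tx_of_Bcomp hS hz.1 m hm
    (GelfandTriplet.Setting.opPow_scalarSub_Hx_zero hS m)⟩
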